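/- **Conventions.** Let $\mathcal E$ be a category with finite limits and an orthogonal factorization system (surjections, embeddings) that is *proper* (every embedding is monic, every regular monomorphism is an embedding) and *stable* under pullback. For $X\in\mathcal E$, let $\mathrm{Sub}(X)$ be the poset of isomorphism classes of embeddings into $X$, called subobjects of $X$; we write $A\subseteq X$. For $f:X\to Y$ let $f^{-1}:\mathrm{Sub}(Y)\to\mathrm{Sub}(X)$ be pullback, and for $A\subseteq X$ let $f[A]\subseteq Y$ be the image of the composite $A\hookrightarrow X\to Y$. - $\mathcal E$ is *f-Boolean* if each $\mathrm{Sub}(X)$ is a Boolean algebra and each $f^{-1}$ is a morphism of Boolean algebras. - $\mathcal E$ is a *modal category* if it is f-Boolean and each $\mathrm{Sub}(X)$ carries an operator $\Diamond$ preserving finite joins such that $\Diamond f^{-1}A\le f^{-1}\Diamond A$ for all $f:X\to Y$, $A\subseteq Y$, and $\Diamond A=m^{-1}\Diamond m[A]$ for all embeddings $m:X\hookrightarrow Y$ and $A\subseteq X$. - A *relation* from $X$ to $Y$ is a subobject $R\subseteq X\times Y$; its reciprocal is $R^{-1}\subseteq Y\times X$, and $RA=\pi_Y[R\wedge\pi_X^{-1}A]$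 for $A\subseteq X$. A *partial map* $f$ from $X$ to $Y$ is a subobject $d:D\hookrightarrow X$ with an arrow $t:D\to Y$; it is identified with the relation given by its graph $(d,t):D\hookrightarrow X\times Y$. A *loop* with anchor $X$ is a sequence of relations $R_1,\dots,R_n$ such that the composite $R_1\circ\cdots\circ R_n$ ($R_n$ applied first) is defined and goes from $X$ to $X$. The *acceptable* loops are the smallest class of loops that contains the empty loop on every anchor and is closed under: inserting identity relations at any place; concatenation of two loops with the same anchor; passing from $w$ to $f,w,f^{-1}$ for $f$ a partial map defined on (a subobject of) the anchor of $w$; and passing from $R_1,\dots,R_n$ and $S_1,\dots,S_n$ to $R_1\times S_1,\dots,R_n\times S_n$. - A modal category is *topological* if: $A\le\Diamond A=\Diamond\Diamond A$ for every subobject $A$; $\pi_X^{-1}\Diamond A\wedge\pi_Y^{-1}\Diamond B\le\Diamond(\pi_X^{-1}A\wedge\pi_Y^{-1}B)$ in $\mathrm{Sub}(X\times Y)$ for all $A\subseteq X$, $B\subseteq Y$; and $\Diamond R_1\Diamond R_2\cdots\Diamond R_nA\le\Diamond A$ for every acceptable loop $R_1,\dots,R_n$ and every subobject $A$ of its anchor.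 - A *Boolean model* of $\mathcal E$ is a functor $M:\mathcal E\to\mathbf{Set}$ that preserves finite limits, sends surjections to surjective maps and embeddings to injective maps, and preserves finite joins of subobjects (including $\bot$). For $\varphi\subseteq X$, $[\![\varphi]\!]_M\subseteq M(X)$ denotes the image of $M(\varphi)\to M(X)$. **Lemma (Extension Lemma).** Let $\mathcal E$ be a small topological modal category. For every Boolean model $M:\mathcal E\to\mathbf{Set}$ there exist a Boolean model $N:\mathcal E\to\mathbf{Set}$, a natural transformation $\mu:M\to N$, and a family $R$ of relations $R_X\subseteq M(X)\times N(X)$ $(X\in\mathcal E)$ such that 1. $R$ is stable under products: if $x\,R_X\,x'$ and $y\,R_Y\,y'$, then $(x,y)\,R_{X\times Y}\,(x',y')$, for every product $X\times Y$ of $X$ and $Y$ in $\mathcal E$, where $M(X\times Y)$ is identified with $M(X)\times M(Y)$, and likewise for $N$; 2. $R$ contains the graph of $\mu$: $x\,R_X\,\mu_X(x)$ for all $X\in\mathcal E$ and $x\in M(X)$; 3. for every $X\in\mathcal E$ and every subobject $\varphi\subseteq X$, $$[\![\Diamond\varphi]\!]_M=R_X^{-1}[\![\varphi]\!]_N=\{x\in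 M(X)\mid \exists\,y\in[\![\varphi]\!]_N,\ x\,R_X\,y\}.$$ -/

import Mathlib

open CategoryTheory CategoryTheory.Limits

universe w v u

namespace ModalCat

noncomputable section

/-- A proper stable orthogonal factorization system `(Surj, Emb)` on a category with finite limits.
Arrows in `Surj` are called surjections, arrows in `Emb` are called embeddings. -/
class ProperStableFactorization (E : Type u) [Category.{v} E] [HasFiniteLimits E] where
  Surj : MorphismProperty E
  Emb : MorphismProperty E
  /-- both classes contain the isomorphisms and are closed under composition -/
  surj_of_iso : ∀ {X Y : E} (f : X ⟶ Y), IsIso f → Surj f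
  emb_of_iso : ∀ {X Y : E} (f : X ⟶ Y), IsIso f → Emb f
  surj_comp : ∀ {X Y Z : E} (f : X ⟶ Y) (g : Y ⟶ Z), Surj f → Surj g → Surj (f ≫ g)
  emb_comp : ∀ {X Y Z : E} (f : X ⟶ Y) (g : Y ⟶ Z), Emb f → Emb g → Emb (f ≫ g)
  /-- every arrow is a surjection followed by an embedding -/
  factor : ∀ {X Y : E} (f : X ⟶ Y),
    ∃ (I : E) (e : X ⟶ I) (m : I ⟶ Y), Surj e ∧ Emb m ∧ e ≫ m = f
  /-- unique diagonal fill-in -/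
  orthogonal : ∀ {A B C D : E} (e : A ⟶ B) (m : C ⟶ D) (f : A ⟶ C) (g : B ⟶ D),
    Surj e → Emb m → f ≫ m = e ≫ g → ∃! d : B ⟶ C, e ≫ d = f ∧ d ≫ m = g
  /-- the system is proper -/
  mono_of_emb : ∀ {X Y : E} (f : X ⟶ Y), Emb f → Mono f
  emb_of_regularMono : ∀ {X Y : E} (f : X ⟶ Y), IsRegularMono f → Emb f
  /-- the system is stable -/
  surj_stable : Surj.IsStableUnderBaseChange
  emb_stable : Emb.IsStableUnderBaseChange

section Sub

variable {E : Type u} [Category.{v} E] [HasFiniteLimits E] [ProperStableFactorization E]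

/-- The property of being an embedding, i.e. of lying in the right class. -/
abbrev Emb {X Y : E} (f : X ⟶ Y) : Prop := ProperStableFactorization.Emb f

/-- The property of being a surjection, i.e. of lying in the left class. -/
abbrev Surj {X Y : E} (f : X ⟶ Y) : Prop := ProperStableFactorization.Surj f

variable (E) in
/-- `Sub X`: isomorphism classes of embeddings into `X`, that is, the subobjects in Mathlib's sense
(isomorphism classes of monomorphisms) whose representing arrow is an embedding. -/
@[ext] structure Sub (X : E) where
  toSubobject : Subobject X
  emb : Emb toSubobject.arrow

/-- The subobject represented by an embedding. -/
def Sub.mk' {X Y : E} (m : X ⟶ Y) (hm : Emb m) : Sub E Y :=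
  have : Mono m := ProperStableFactorization.mono_of_emb m hm
  { toSubobject := Subobject.mk m
    emb := by
      rw [← Subobject.underlyingIso_hom_comp_eq_mk m]
      exact ProperStableFactorization.emb_comp _ _
        (ProperStableFactorization.emb_of_iso _ inferInstance) hm }

/-- The underlying object of a subobject. -/
abbrev Sub.dom {X : E} (A : Sub E X) : E := (A.toSubobject : E)

/-- The embedding that represents a subobject. -/
abbrev Sub.arrow {X : E} (A : Sub E X) : A.dom ⟶ X := A.toSubobject.arrow

theorem Sub.emb_arrow {X : E} (A : Sub E X) : Emb A.arrow := A.emb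

/-- Inverse image `f⁻¹ A` (pullback along `f`). -/
def inv {X Y : E} (f : X ⟶ Y) (A : Sub E Y) : Sub E X where
  toSubobject := (Subobject.pullback f).obj A.toSubobject
  emb := ProperStableFactorization.emb_stable.of_isPullback
    (Subobject.isPullback f A.toSubobject) A.emb

/-- The image of an arrow: the embedding part of its factorization. -/
def image {X Y : E} (f : X ⟶ Y) : Sub E Y :=
  Sub.mk' (ProperStableFactorization.factor f).choose_spec.choose_spec.choose
    (ProperStableFactorization.factor f).choose_spec.choose_spec.choose_spec.2.1

/-- Direct image `∃_f A`: the image of the composite `A ↪ X ⟶ Y`. -/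
def dir {X Y : E} (f : X ⟶ Y) (A : Sub E X) : Sub E Y := image (A.arrow ≫ f)

end Sub

/-- An f-Boolean category. Each poset `Sub X`, ordered by inclusion, is a Boolean algebra, and
pulling back is a morphism of Boolean algebras. -/
class FBooleanCategory (E : Type u) [Category.{v} E] [HasFiniteLimits E] extends
    ProperStableFactorization E where
  boolAlg : ∀ X : E, BooleanAlgebra (Sub E X)
  le_iff : ∀ {X : E} (A B : Sub E X), A ≤ B ↔ A.toSubobject ≤ B.toSubobject
  inv_top : ∀ {X Y : E} (f : X ⟶ Y), inv f (⊤ : Sub E Y) = ⊤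
  inv_bot : ∀ {X Y : E} (f : X ⟶ Y), inv f (⊥ : Sub E Y) = ⊥
  inv_inf : ∀ {X Y : E} (f : X ⟶ Y) (A B : Sub E Y), inv f (A ⊓ B) = inv f A ⊓ inv f B
  inv_sup : ∀ {X Y : E} (f : X ⟶ Y) (A B : Sub E Y), inv f (A ⊔ B) = inv f A ⊔ inv f B

attribute [instance, reducible] FBooleanCategory.boolAlg

/-- A (Boolean) modal category: an f-Boolean category with a finite-join-preserving operator `◇` on
each `Sub X`, such that inverse images are lax morphisms, and such that the operator on the domain
of an embedding is induced by the operator on the codomain. -/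
class ModalCategory (E : Type u) [Category.{v} E] [HasFiniteLimits E] extends
    FBooleanCategory E where
  dia : ∀ {X : E}, Sub E X → Sub E X
  dia_bot : ∀ X : E, dia (⊥ : Sub E X) = ⊥
  dia_sup : ∀ {X : E} (A B : Sub E X), dia (A ⊔ B) = dia A ⊔ dia B
  dia_inv_le : ∀ {X Y : E} (f : X ⟶ Y) (A : Sub E Y), dia (inv f A) ≤ inv f (dia A)
  dia_emb : ∀ {X Y : E} (m : X ⟶ Y), Emb m → ∀ A : Sub E X, dia A = inv m (dia (dir m A))

section Relations

variable {E : Type u} [Category.{v} E] [HasFiniteLimits E]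

/-- If `f ≫ g` is an embedding then so is `f`. -/
theorem emb_of_comp [ProperStableFactorization E] {X Y Z : E} (f : X ⟶ Y) (g : Y ⟶ Z)
    (h : Emb (f ≫ g)) : Emb f := by
  obtain ⟨I, e, m, he, hm, rfl⟩ := ProperStableFactorization.factor f
  obtain ⟨d, ⟨hd, -⟩, -⟩ := ProperStableFactorization.orthogonal e ((e ≫ m) ≫ g) (𝟙 X) (m ≫ g)
    he h (by simp)
  have : IsSplitMono e := ⟨⟨⟨d, hd⟩⟩⟩
  exact ProperStableFactorization.emb_comp _ _
    (ProperStableFactorization.emb_of_regularMono e inferInstance) hm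

variable [FBooleanCategory E]

variable (E) in
/-- A binary relation `R ⊆ X × Y`, regarded as a relation from `X` to `Y`. -/
abbrev Rel (X Y : E) : Type (max u v) := Sub E (X ⨯ Y)

/-- Direct image of `A ⊆ X` under `R ⊆ X × Y`: `R A = π_Y [R ∧ π_X⁻¹ A]`. -/
def Rel.dir {X Y : E} (R : Rel E X Y) (A : Sub E X) : Sub E Y :=
  ModalCat.dir (prod.snd : X ⨯ Y ⟶ Y) (R ⊓ inv (prod.fst : X ⨯ Y ⟶ X) A)

/-- The reciprocal relation `R⁻¹ ⊆ Y × X`. -/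
def Rel.symm {X Y : E} (R : Rel E X Y) : Rel E Y X :=
  inv (prod.lift prod.snd prod.fst : Y ⨯ X ⟶ X ⨯ Y) R

/-- The product `R × S ⊆ (X × X') × (Y × Y')` of `R ⊆ X × Y` and `S ⊆ X' × Y'`. -/
def Rel.prod {X Y X' Y' : E} (R : Rel E X Y) (S : Rel E X' Y') : Rel E (X ⨯ X') (Y ⨯ Y') :=
  inv (prod.map prod.fst prod.fst : (X ⨯ X') ⨯ (Y ⨯ Y') ⟶ X ⨯ Y) R ⊓
    inv (prod.map prod.snd prod.snd : (X ⨯ X') ⨯ (Y ⨯ Y') ⟶ X' ⨯ Y') S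

variable (E) in
/-- A partial map from `X` to `Y`: an arrow into `Y` defined on a subobject of `X`. -/
structure PartialMap (X Y : E) where
  dom : Sub E X
  map : dom.dom ⟶ Y

/-- The graph of a partial map, as a relation. -/
def PartialMap.graph {X Y : E} (f : PartialMap E X Y) : Rel E X Y :=
  Sub.mk' (prod.lift f.dom.arrow f.map)
    (emb_of_comp _ prod.fst (by rw [prod.lift_fst]; exact f.dom.emb_arrow))

variable (E) in
/-- The identity relation: the diagonal of `X`. -/
def Rel.id (X : E) : Rel E X X :=
  Sub.mk' (prod.lift (𝟙 X) (𝟙 X))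
    (emb_of_comp _ prod.fst (by
      rw [prod.lift_fst]; exact ProperStableFactorization.emb_of_iso _ inferInstance))

variable (E) in
/-- A composable sequence `R₁, …, Rₙ` of relations from `X` to `Y`, written in the order of
`R₁ ∘ ⋯ ∘ Rₙ`: the domain of `Rₙ` is `X`, the codomain of `R₁` is `Y`. -/
inductive Path : E → E → Type (max u v)
  | nil (X : E) : Path X X
  | cons {X Y Z : E} (R : Rel E Y Z) (p : Path X Y) : Path X Z

/-- Concatenation of the sequences `p` and `q`, in this order. -/
def Path.append {X Y Z : E} : Path E Y Z → Path E X Y → Path E X Z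
  | .nil _, q => q
  | .cons R p, q => .cons R (p.append q)

def Path.length {X Y : E} : Path E X Y → ℕ
  | .nil _ => 0
  | .cons _ p => p.length + 1

/-- The pointwise product `R₁ × S₁, …, Rₙ × Sₙ` of two sequences of the same length. -/
def Path.prod {X Y X' Y' : E} : (p : Path E X Y) → (q : Path E X' Y') → p.length = q.length →
    Path E (X ⨯ X') (Y ⨯ Y')
  | .nil _, .nil _, _ => .nil _
  | .cons R p, .cons S q, h => .cons (R.prod S) (p.prod q (Nat.succ.inj h))
  | .nil _, .cons _ _, h => absurd h (Nat.succ_ne_zero _).symm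
  | .cons _ _, .nil _, h => absurd h (Nat.succ_ne_zero _)

/-- The acceptable loops. A loop with anchor `X` is a composable sequence from `X` to `X`. -/
inductive Acceptable : {X : E} → Path E X X → Prop
  | nil (X : E) : Acceptable (Path.nil X)
  | insert_id {X Y : E} (p : Path E Y X) (q : Path E X Y) :
      Acceptable (p.append q) → Acceptable (p.append (.cons (Rel.id E Y) q))
  | append {X : E} (p q : Path E X X) : Acceptable p → Acceptable q → Acceptable (p.append q)
  | conj {X Y : E} (f : PartialMap E X Y) (p : Path E X X) : Acceptable p →
      Acceptable (.cons f.graph (p.append (.cons f.graph.symm (.nil Y))))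
  | prod {X Y : E} (p : Path E X X) (q : Path E Y Y) (h : p.length = q.length) :
      Acceptable p → Acceptable q → Acceptable (p.prod q h)

end Relations

section Topological

variable {E : Type u} [Category.{v} E] [HasFiniteLimits E] [ModalCategory E]

/-- The modal operator `◇` on `Sub X`. -/
def dia {X : E} (A : Sub E X) : Sub E X := ModalCategory.dia A

/-- `◇ R₁ ◇ R₂ ◇ ⋯ ◇ Rₙ A`. -/
def Path.diaDir {X Y : E} : Path E X Y → Sub E X → Sub E Y
  | .nil _, A => A
  | .cons R p, A => dia (R.dir (p.diaDir A))

end Topological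

/-- A topological modal category: a modal category satisfying the closure axiom (S4), the product
independence axiom (PI), and the loop contraction axiom (LC) for all acceptable loops. -/
class TopologicalModalCategory (E : Type u) [Category.{v} E] [HasFiniteLimits E] extends
    ModalCategory E where
  le_dia : ∀ {X : E} (A : Sub E X), A ≤ ModalCat.dia A
  dia_dia : ∀ {X : E} (A : Sub E X), ModalCat.dia (ModalCat.dia A) = ModalCat.dia A
  product_independence : ∀ {X Y : E} (A : Sub E X) (B : Sub E Y),
    inv (prod.fst : X ⨯ Y ⟶ X) (ModalCat.dia A) ⊓ inv (prod.snd : X ⨯ Y ⟶ Y) (ModalCat.dia B) ≤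
      ModalCat.dia (inv (prod.fst : X ⨯ Y ⟶ X) A ⊓ inv (prod.snd : X ⨯ Y ⟶ Y) B)
  loop_contraction : ∀ {X : E} (p : Path E X X), Acceptable p →
    ∀ A : Sub E X, p.diaDir A ≤ ModalCat.dia A

section Models

variable {E : Type u} [Category.{v} E] [HasFiniteLimits E]

/-- The interpretation `⟦A⟧_M ⊆ M(X)` of a subobject `A ⊆ X` under a set-valued functor: the image
of `M(A) → M(X)`. -/
def interp [ProperStableFactorization E] (M : E ⥤ Type w) {X : E} (A : Sub E X) : Set (M.obj X) :=
  Set.range (M.map A.arrow)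

/-- A Boolean model: an f-Boolean functor `E ⥤ Type w`, where sets carry the factorization system
of surjective and injective functions (so that the subobjects of a set are its subsets). That is,
a functor which preserves finite limits, the factorization system, and finite joins of
subobjects. -/
structure IsBooleanModel [FBooleanCategory E] (M : E ⥤ Type w) : Prop where
  lex : PreservesFiniteLimits M
  map_surj : ∀ {X Y : E} (f : X ⟶ Y), Surj f → Function.Surjective (M.map f)
  map_emb : ∀ {X Y : E} (f : X ⟶ Y), Emb f → Function.Injective (M.map f)
  interp_bot : ∀ X : E, interp M (⊥ : Sub E X) = ∅
  interp_sup : ∀ {X : E} (A B : Sub E X), interp M (A ⊔ B) = interp M A ∪ interp M B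

/-- A relation `R ⊆ M × N` between set-valued functors: an arbitrary family of subsets
`R(X) ⊆ M(X) × N(X)`. -/
abbrev FunctorRel (M N : E ⥤ Type w) : Type (max u w) := ∀ X : E, Set (M.obj X × N.obj X)

/-- Stability under products: if `x R(X) x'` and `y R(Y) y'` then `(x, y) R(X × Y) (x', y')`.
Here `X × Y` is any product `P` of `X` and `Y` in `E`, and a point of `M(P)` or `N(P)` is given by
its two components. -/
def FunctorRel.StableUnderProducts {M N : E ⥤ Type w} (R : FunctorRel M N) : Prop :=
  ∀ (X Y P : E) (p₁ : P ⟶ X) (p₂ : P ⟶ Y), Nonempty (IsLimit (BinaryFan.mk p₁ p₂)) →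
    ∀ (z : M.obj P) (z' : N.obj P),
      (M.map p₁ z, N.map p₁ z') ∈ R X → (M.map p₂ z, N.map p₂ z') ∈ R Y → (z, z') ∈ R P

/-- `R` contains the graph of the natural transformation `μ`. -/
def FunctorRel.ContainsGraph {M N : E ⥤ Type w} (R : FunctorRel M N) (μ : M ⟶ N) : Prop :=
  ∀ (X : E) (x : M.obj X), (x, μ.app X x) ∈ R X

/-- The inverse image `R⁻¹ S ⊆ M(X)` of a subset `S ⊆ N(X)`. -/
def FunctorRel.preimage {M N : E ⥤ Type w} (R : FunctorRel M N) {X : E} (S : Set (N.obj X)) :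
    Set (M.obj X) :=
  {x | ∃ y ∈ S, (x, y) ∈ R X}

end Models

end

end ModalCat

namespace ModalCat

noncomputable section

open Filter

/-! ### Factorizations and pullbacks on representing embeddings. -/

section Subobjects

variable {E : Type u} [Category.{v} E] [HasFiniteLimits E]

variable [ProperStableFactorization E]

/-! `N` is an ultrapower of `M`. Every point `x ∈ ⟦◇φ⟧` demands a related point in `⟦φ⟧`; the index
set consists of all ways `i` of assigning a point to every demand. A family `h` of points of `M(X)`
represents a point of `N(X)`, and it is related to `x` when one arrow of `E` produces `x` from the
demanding points and a parameter, and `h i` from the values of `i` and the same parameter, using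
finitely many demands. Constants give `μ`, evaluation at a demand gives its witness, and pairing
gives stability under products.

The ultrafilter must concentrate on assignments that satisfy all demands, and `h i` must avoid `ψ`
almost everywhere whenever `x ∉ ⟦◇ψ⟧`. These requirements are consistent: two of them combine into
one since `◇` preserves joins and is lax for inverse images, and a single one is met by induction on
the demands involved (`IsBooleanModel.exists_maps`). The inductive step is product independence,
contraposed in `IsBooleanModel.notMem_dia_forallMem`: a demand is removed by quantifying universally
over `φ`. With no demand left, `ψ ≤ ◇ψ` suffices. -/

theorem exists_iso_dom_mk' {X Y : E} (m : X ⟶ Y) (hm : Emb m) :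
    ∃ i : X ≅ (Sub.mk' m hm).dom, i.hom ≫ (Sub.mk' m hm).arrow = m :=
  have : Mono m := ProperStableFactorization.mono_of_emb m hm
  ⟨(Subobject.underlyingIso m).symm, Subobject.underlyingIso_arrow m⟩

theorem exists_surj_comp_dir {X Y : E} (f : X ⟶ Y) (A : Sub E X) :
    ∃ e : A.dom ⟶ (dir f A).dom, Surj e ∧ e ≫ (dir f A).arrow = A.arrow ≫ f := by
  obtain ⟨he, hm, hf⟩ :=
    (ProperStableFactorization.factor (A.arrow ≫ f)).choose_spec.choose_spec.choose_spec
  obtain ⟨i, hi⟩ := exists_iso_dom_mk' _ hm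
  refine ⟨_ ≫ i.hom, ProperStableFactorization.surj_comp _ _ he
    (ProperStableFactorization.surj_of_iso _ i.isIso_hom), ?_⟩
  exact ((Category.assoc _ _ _).trans (congrArg _ hi)).trans hf

theorem exists_isPullback_inv {X Y : E} (f : X ⟶ Y) (A : Sub E Y) :
    ∃ p : (inv f A).dom ⟶ A.dom, IsPullback p (inv f A).arrow A.arrow f :=
  ⟨_, Subobject.isPullback f A.toSubobject⟩

end Subobjects

/-! ### Adjunction between images and inverse images; universal quantification. -/

section BooleanSubobjects

variable {E : Type u} [Category.{v} E] [HasFiniteLimits E] [FBooleanCategory E]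

theorem Sub.le_iff_exists {X : E} (A B : Sub E X) :
    A ≤ B ↔ ∃ g : A.dom ⟶ B.dom, g ≫ B.arrow = A.arrow := by
  rw [FBooleanCategory.le_iff]
  exact ⟨fun h => ⟨Subobject.ofLE _ _ h, Subobject.ofLE_arrow h⟩,
    fun ⟨g, hg⟩ => Subobject.le_of_comm g hg⟩

theorem le_inv_iff_exists {X Y : E} (f : X ⟶ Y) (A : Sub E X) (B : Sub E Y) :
    A ≤ inv f B ↔ ∃ g : A.dom ⟶ B.dom, g ≫ B.arrow = A.arrow ≫ f := by
  obtain ⟨p, hp⟩ := exists_isPullback_inv f B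
  rw [Sub.le_iff_exists]
  constructor
  · rintro ⟨g, hg⟩
    exact ⟨g ≫ p, by rw [Category.assoc, hp.w, ← hg, Category.assoc]⟩
  · rintro ⟨g, hg⟩
    exact ⟨hp.lift g A.arrow hg, hp.lift_snd _ _ _⟩

/-- Orthogonality of the surjective part of `A ↪ X ⟶ Y` to the embedding of `B` makes the image the
least subobject through which the composite factors. -/
theorem dir_le_iff {X Y : E} (f : X ⟶ Y) (A : Sub E X) (B : Sub E Y) :
    dir f A ≤ B ↔ A ≤ inv f B := by
  obtain ⟨e, he, hef⟩ := exists_surj_comp_dir f A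
  rw [le_inv_iff_exists, Sub.le_iff_exists]
  constructor
  · rintro ⟨g, hg⟩
    exact ⟨e ≫ g, by rw [Category.assoc, hg, hef]⟩
  · rintro ⟨g, hg⟩
    obtain ⟨d, ⟨-, hd⟩, -⟩ := ProperStableFactorization.orthogonal e B.arrow g
      (dir f A).arrow he B.emb (hg.trans hef.symm)
    exact ⟨d, hd⟩

theorem inv_compl {X Y : E} (f : X ⟶ Y) (A : Sub E Y) : inv f Aᶜ = (inv f A)ᶜ := by
  refine (IsCompl.compl_eq ?_).symm
  refine IsCompl.of_eq ?_ ?_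
  · rw [← FBooleanCategory.inv_inf, inf_compl_eq_bot, FBooleanCategory.inv_bot]
  · rw [← FBooleanCategory.inv_sup, sup_compl_eq_top, FBooleanCategory.inv_top]

/-- The universal quantification `∀ y ∈ B, (x, y) ∈ C`, as a subobject of `X`. -/
def forallMem {X Y : E} (B : Sub E Y) (C : Sub E (X ⨯ Y)) : Sub E X :=
  (dir (prod.fst : X ⨯ Y ⟶ X) (inv (prod.snd : X ⨯ Y ⟶ Y) B ⊓ Cᶜ))ᶜ

/-- This is the counit of universal quantification: inverse images commute with complements, so the
unit of the image adjunction makes the left side disjoint from `Cᶜ`. -/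
theorem inv_forallMem_inf_le {X Y : E} (B : Sub E Y) (C : Sub E (X ⨯ Y)) :
    inv (prod.fst : X ⨯ Y ⟶ X) (forallMem B C) ⊓ inv (prod.snd : X ⨯ Y ⟶ Y) B ≤ C := by
  have h := (dir_le_iff (prod.fst : X ⨯ Y ⟶ X) (inv (prod.snd : X ⨯ Y ⟶ Y) B ⊓ Cᶜ) _).1 le_rfl
  rw [forallMem, inv_compl, ← sdiff_eq_bot_iff, sdiff_eq, inf_assoc, ← le_bot_iff]
  exact (inf_le_inf_left _ h).trans (compl_inf_self _).le

end BooleanSubobjects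

/-! ### Points of set-valued functors. -/

section Points

variable {E : Type u} [Category.{v} E]

theorem map_comp_app (M : E ⥤ Type w) {X Y Z : E} (f : X ⟶ Y) (g : Y ⟶ Z) (x : M.obj X) :
    M.map (f ≫ g) x = M.map g (M.map f x) := by
  rw [M.map_comp]; rfl

theorem map_id_app (M : E ⥤ Type w) {X : E} (x : M.obj X) : M.map (𝟙 X) x = x := by
  rw [M.map_id]; rfl

theorem existsUnique_of_isLimit_binaryFan (M : E ⥤ Type w) [PreservesFiniteLimits M] {X Y P : E}
    {p₁ : P ⟶ X} {p₂ : P ⟶ Y} (hP : IsLimit (BinaryFan.mk p₁ p₂)) (x : M.obj X) (y : M.obj Y) :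
    ∃! z : M.obj P, M.map p₁ z = x ∧ M.map p₂ z = y := by
  have h := mapIsLimitOfPreservesOfIsLimit M p₁ p₂ hP
  obtain ⟨l, hl₁, hl₂⟩ := BinaryFan.IsLimit.lift' h (↾fun _ : PUnit => x) (↾fun _ : PUnit => y)
  refine ⟨l PUnit.unit, ⟨ConcreteCategory.congr_hom hl₁ PUnit.unit,
    ConcreteCategory.congr_hom hl₂ PUnit.unit⟩, fun z hz => ?_⟩
  have : (↾fun _ : PUnit => z) = l := by
    apply BinaryFan.IsLimit.hom_ext h
    · rw [hl₁]; ext; exact hz.1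
    · rw [hl₂]; ext; exact hz.2
  exact ConcreteCategory.congr_hom this PUnit.unit

end Points

/-! ### Boolean models interpret the logical operations pointwise. -/

section Interp

variable {E : Type u} [Category.{v} E] [HasFiniteLimits E] [FBooleanCategory E] {M : E ⥤ Type w}

theorem interp_mono (M : E ⥤ Type w) {X : E} {A B : Sub E X} (h : A ≤ B) :
    interp M A ⊆ interp M B := by
  obtain ⟨g, hg⟩ := (Sub.le_iff_exists A B).1 h
  rintro _ ⟨a, rfl⟩
  exact ⟨M.map g a, by rw [← map_comp_app, hg]⟩

theorem mem_interp_top (M : E ⥤ Type w) {X : E} (x : M.obj X) : x ∈ interp M (⊤ : Sub E X) := by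
  obtain ⟨i, hi⟩ :=
    exists_iso_dom_mk' (𝟙 X) (ProperStableFactorization.emb_of_iso _ inferInstance)
  exact interp_mono M le_top ⟨M.map i.hom x, by rw [← map_comp_app, hi, map_id_app]⟩

namespace IsBooleanModel

variable (hM : IsBooleanModel M)
include hM

theorem mem_interp_inv {X Y : E} (f : X ⟶ Y) (A : Sub E Y) (x : M.obj X) :
    x ∈ interp M (inv f A) ↔ M.map f x ∈ interp M A := by
  have := hM.lex
  obtain ⟨p, hp⟩ := exists_isPullback_inv f A
  constructor
  · rintro ⟨a, rfl⟩
    exact ⟨M.map p a, by rw [← map_comp_app, ← map_comp_app, hp.w]⟩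
  · rintro ⟨a, ha⟩
    obtain ⟨b, -, hb⟩ := Types.exists_of_isPullback (hp.map M) a x ha
    exact ⟨b, hb⟩

theorem mem_interp_dir {X Y : E} (f : X ⟶ Y) (A : Sub E X) (y : M.obj Y) :
    y ∈ interp M (dir f A) ↔ ∃ x ∈ interp M A, M.map f x = y := by
  obtain ⟨e, he, hef⟩ := exists_surj_comp_dir f A
  constructor
  · rintro ⟨b, rfl⟩
    obtain ⟨a, rfl⟩ := hM.map_surj e he b
    exact ⟨M.map A.arrow a, ⟨a, rfl⟩, by rw [← map_comp_app, ← map_comp_app, hef]⟩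
  · rintro ⟨_, ⟨a, rfl⟩, rfl⟩
    exact ⟨M.map e a, by rw [← map_comp_app, ← map_comp_app, hef]⟩

theorem mem_interp_inf {X : E} (A B : Sub E X) (x : M.obj X) :
    x ∈ interp M (A ⊓ B) ↔ x ∈ interp M A ∧ x ∈ interp M B := by
  refine ⟨fun h => ⟨interp_mono M inf_le_left h, interp_mono M inf_le_right h⟩, ?_⟩
  rintro ⟨⟨a, rfl⟩, hB⟩
  -- The meet is only known through the order, so the concrete intersection, `B` restricted to `A`
  -- and pushed forward again, is shown to lie below it.
  have hle : dir A.arrow (inv A.arrow B) ≤ A ⊓ B := by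
    refine le_inf ?_ ?_
    · rw [dir_le_iff, le_inv_iff_exists]
      exact ⟨(inv A.arrow B).arrow, rfl⟩
    · rw [dir_le_iff]
  exact interp_mono M hle ((hM.mem_interp_dir _ _ _).2 ⟨a, (hM.mem_interp_inv _ _ _).2 hB, rfl⟩)

theorem mem_interp_compl {X : E} (A : Sub E X) (x : M.obj X) :
    x ∈ interp M Aᶜ ↔ x ∉ interp M A := by
  constructor
  · intro h h'
    have := (hM.mem_interp_inf A Aᶜ x).2 ⟨h', h⟩
    rw [inf_compl_eq_bot, hM.interp_bot] at this
    exact this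
  · intro h
    have := mem_interp_top M x
    rw [← sup_compl_eq_top (x := A), hM.interp_sup] at this
    exact this.resolve_left h

theorem mem_interp_forallMem {X Y : E} (B : Sub E Y) (C : Sub E (X ⨯ Y)) (x : M.obj X) :
    x ∈ interp M (forallMem B C) ↔ ∀ z : M.obj (X ⨯ Y),
      M.map prod.fst z = x → M.map prod.snd z ∈ interp M B → z ∈ interp M C := by
  rw [forallMem, hM.mem_interp_compl, hM.mem_interp_dir]
  simp only [hM.mem_interp_inf, hM.mem_interp_inv, hM.mem_interp_compl]
  constructor
  · intro h z hz hB
    by_contra hC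
    exact h ⟨z, ⟨hB, hC⟩, hz⟩
  · rintro h ⟨z, ⟨hB, hC⟩, hz⟩
    exact hC (h z hz hB)

end IsBooleanModel

end Interp

/-! ### Ultrapowers of Boolean models and Łoś's theorem for subobjects. -/

section Ultrapower

variable {I : Type w} (U : Ultrafilter I)

/-- The ultrapower functor on sets. -/
def germFunctor : Type w ⥤ Type w where
  obj A := (U : Filter I).Germ A
  map f := ↾(Germ.map f)
  map_id A := by
    ext a
    exact congrFun Germ.map_id a
  map_comp f g := by
    ext a
    exact (Germ.map_map (l := (U : Filter I)) g f a).symm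

theorem isPullback_germFunctor_map {A B C D : Type w} {t : A ⟶ B} {l : A ⟶ C} {r : B ⟶ D}
    {b : C ⟶ D} (h : IsPullback t l r b) :
    IsPullback ((germFunctor U).map t) ((germFunctor U).map l) ((germFunctor U).map r)
      ((germFunctor U).map b) := by
  rw [Types.isPullback_iff]
  refine ⟨by rw [← Functor.map_comp, h.w, Functor.map_comp], ?_, ?_⟩
  · intro x y
    refine Germ.inductionOn₂ x y fun x y => ?_
    rintro ⟨h₁, h₂⟩
    have h₁ := Germ.coe_eq.1 h₁
    have h₂ := Germ.coe_eq.1 h₂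
    refine Germ.coe_eq.2 ?_
    filter_upwards [h₁, h₂] with i h₁ h₂
    exact Types.ext_of_isPullback h h₁ h₂
  · intro x y
    refine Germ.inductionOn₂ x y fun x y => ?_
    intro hxy
    have hxy : ∀ᶠ i in (U : Filter I), r (x i) = b (y i) := Germ.coe_eq.1 hxy
    obtain ⟨i₀, hi₀⟩ := hxy.exists
    -- A default value for the indices where the equation fails; it exists because the equation
    -- holds at some index.
    obtain ⟨a₀, -⟩ := Types.exists_of_isPullback h _ _ hi₀
    have key : ∀ i, ∃ a : A, r (x i) = b (y i) → t a = x i ∧ l a = y i := fun i => by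
      by_cases hi : r (x i) = b (y i)
      · obtain ⟨a, ha⟩ := Types.exists_of_isPullback h _ _ hi
        exact ⟨a, fun _ => ha⟩
      · exact ⟨a₀, fun hi' => absurd hi' hi⟩
    choose a ha using key
    exact ⟨(a : (U : Filter I).Germ A), Germ.coe_eq.2 (hxy.mono fun i hi => (ha i hi).1),
      Germ.coe_eq.2 (hxy.mono fun i hi => (ha i hi).2)⟩

theorem preservesFiniteLimits_germFunctor : PreservesFiniteLimits (germFunctor U) := by
  have : PreservesLimitsOfShape WalkingCospan (germFunctor U) := by
    refine ⟨fun {K} => ?_⟩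
    have h : PreservesLimit (cospan (K.map WalkingCospan.Hom.inl) (K.map WalkingCospan.Hom.inr))
        (germFunctor U) :=
      preservesLimit_of_preserves_limit_cone
        (IsPullback.of_hasPullback _ _).isLimit
        ((isLimitMapConePullbackConeEquiv (germFunctor U) pullback.condition).symm
          (isPullback_germFunctor_map U (IsPullback.of_hasPullback _ _)).isLimit)
    exact preservesLimit_of_iso_diagram _ (diagramIsoCospan K).symm
  have : PreservesLimit (Functor.empty.{0} (Type w)) (germFunctor U) :=
    preservesLimit_of_preserves_limit_cone Types.isTerminalPUnit
      ((isLimitMapConeEmptyConeEquiv _ _).symm ((Types.isTerminalEquivUnique _).symm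
        { default := ((fun _ => PUnit.unit : I → PUnit) : (U : Filter I).Germ PUnit)
          uniq := fun a => Germ.inductionOn (p := fun a : (U : Filter I).Germ PUnit => a = _) a
            fun _ => rfl }))
  have := preservesLimitsOfShape_pempty_of_preservesTerminal (germFunctor U)
  exact preservesFiniteLimits_of_preservesTerminal_and_pullbacks (germFunctor U)

variable {E : Type u} [Category.{v} E]

/-- The ultrapower of a set-valued functor. -/
abbrev ultrapower (M : E ⥤ Type w) : E ⥤ Type w := M ⋙ germFunctor U

/-- The diagonal embedding of a set-valued functor into its ultrapower. -/
def toUltrapower (M : E ⥤ Type w) : M ⟶ ultrapower U M where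
  app X := ↾fun x => ((fun _ => x : I → M.obj X) : (U : Filter I).Germ (M.obj X))
  naturality X Y f := by
    ext x
    rfl

variable [HasFiniteLimits E] [FBooleanCategory E]

/-- Łoś's theorem for a subobject: preimages under `M(A) → M(X)` are chosen index by index, with a
default off the good set. -/
theorem coe_mem_interp_ultrapower (M : E ⥤ Type w) {X : E} (A : Sub E X) (h : I → M.obj X) :
    (h : (U : Filter I).Germ (M.obj X)) ∈ interp (ultrapower U M) A ↔
      ∀ᶠ i in (U : Filter I), h i ∈ interp M A := by
  constructor
  · rintro ⟨a, ha⟩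
    revert ha
    refine Germ.inductionOn a fun a ha => ?_
    have ha : ∀ᶠ i in (U : Filter I), M.map A.arrow (a i) = h i := Germ.coe_eq.1 ha
    exact ha.mono fun i hi => ⟨a i, hi⟩
  · intro hA
    obtain ⟨i₀, a₀, -⟩ := hA.exists
    have key : ∀ i, ∃ a, h i ∈ interp M A → M.map A.arrow a = h i := fun i => by
      by_cases hi : h i ∈ interp M A
      · exact ⟨hi.choose, fun _ => hi.choose_spec⟩
      · exact ⟨a₀, fun hi' => absurd hi' hi⟩
    choose a ha using key
    exact ⟨(a : (U : Filter I).Germ (M.obj A.dom)), Germ.coe_eq.2 (hA.mono ha)⟩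

theorem IsBooleanModel.ultrapower {M : E ⥤ Type w} (hM : IsBooleanModel M) :
    IsBooleanModel (ultrapower U M) where
  lex := by
    have := hM.lex
    have := preservesFiniteLimits_germFunctor U
    infer_instance
  map_surj f hf y := by
    refine Germ.inductionOn y fun y => ?_
    choose x hx using fun i => hM.map_surj f hf (y i)
    exact ⟨(x : (U : Filter I).Germ _), Germ.coe_eq.2 (Eventually.of_forall hx)⟩
  map_emb f hf x y := by
    refine Germ.inductionOn₂ x y fun x y h => ?_
    exact Germ.coe_eq.2 ((Germ.coe_eq.1 h).mono fun i hi => hM.map_emb f hf hi)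
  interp_bot X := by
    refine Set.eq_empty_of_forall_notMem fun y => Germ.inductionOn y fun y hy => ?_
    obtain ⟨i, hi⟩ := ((coe_mem_interp_ultrapower U M _ y).1 hy).exists
    rw [hM.interp_bot] at hi
    exact hi
  interp_sup A B := by
    ext y
    refine Germ.inductionOn y fun y => ?_
    refine (coe_mem_interp_ultrapower U M (A ⊔ B) y).trans ?_
    rw [hM.interp_sup]
    -- Joins are where an ultrafilter, rather than just a proper filter, is needed.
    exact Ultrafilter.eventually_or.trans (or_congr (coe_mem_interp_ultrapower U M A y).symm
      (coe_mem_interp_ultrapower U M B y).symm)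

end Ultrapower

/-! ### Demands, supported families, and the ultrafilter. -/

section Extension

variable {E : Type u} [Category.{v} E] [HasFiniteLimits E] [TopologicalModalCategory E]

/-- A demand: a point `x` of `M(X)` in `⟦◇φ⟧`, which requires a related point in `⟦φ⟧`. -/
structure Demand (M : E ⥤ Type w) where
  obj : E
  sub : Sub E obj
  pt : M.obj obj
  mem : pt ∈ interp M (dia sub)

/-- An assignment of points to all demands. -/
abbrev Assignment (M : E ⥤ Type w) := ∀ g : Demand M, M.obj g.obj

/-- The assignment satisfies all demands. -/
def Assignment.Satisfies {M : E ⥤ Type w} (i : Assignment M) : Prop :=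
  ∀ g : Demand M, i g ∈ interp M g.sub

/-- The point `x` with the family of points `h` is the image of `y` with the family `k`
under some arrow. -/
def Maps (M : E ⥤ Type w) {Q X : E} (y : M.obj Q) (k : Assignment M → M.obj Q)
    (x : M.obj X) (h : Assignment M → M.obj X) : Prop :=
  ∃ f : Q ⟶ X, M.map f y = x ∧ ∀ i, M.map f (k i) = h i

variable {M : E ⥤ Type w}

theorem Maps.trans {P Q X : E} {z : M.obj P} {l : Assignment M → M.obj P}
    {y : M.obj Q} {k : Assignment M → M.obj Q}
    {x : M.obj X} {h : Assignment M → M.obj X}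
    (h₁ : Maps M z l y k) (h₂ : Maps M y k x h) : Maps M z l x h := by
  obtain ⟨f, hf, hf'⟩ := h₁
  obtain ⟨g, hg, hg'⟩ := h₂
  exact ⟨f ≫ g, by rw [map_comp_app, hf, hg], fun i => by rw [map_comp_app, hf', hg']⟩

/-- The pair `(x, h)` is definable from finitely many demands and a parameter. -/
def FinSupported {X : E} (x : M.obj X) (h : Assignment M → M.obj X) : Prop :=
  ∃ (s : Finset (Demand M)) (W : E) (w : M.obj W),
    ∀ (Q : E) (y : M.obj Q) (k : Assignment M → M.obj Q), Maps M y k w (fun _ => w) →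
      (∀ g ∈ s, Maps M y k g.pt (fun i => i g)) → Maps M y k x h

theorem finSupported_const {X : E} (x : M.obj X) : FinSupported x (fun _ => x) :=
  ⟨∅, X, x, fun _ _ _ h _ => h⟩

theorem finSupported_eval (g : Demand M) : FinSupported g.pt (fun i => i g) :=
  ⟨{g}, g.obj, g.pt, fun _ _ _ _ h => h g (Finset.mem_singleton_self g)⟩

/-- The supports are united and the parameters are paired; the two resulting arrows then combine
into one arrow to `P`. -/
theorem FinSupported.pair (hM : IsBooleanModel M) {X Y P : E} {p₁ : P ⟶ X} {p₂ : P ⟶ Y}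
    (hP : IsLimit (BinaryFan.mk p₁ p₂)) {z : M.obj P} {h : Assignment M → M.obj P}
    (h₁ : FinSupported (M.map p₁ z) fun i => M.map p₁ (h i))
    (h₂ : FinSupported (M.map p₂ z) fun i => M.map p₂ (h i)) : FinSupported z h := by
  classical
  have := hM.lex
  obtain ⟨s₁, W₁, w₁, h₁⟩ := h₁
  obtain ⟨s₂, W₂, w₂, h₂⟩ := h₂
  obtain ⟨w, ⟨rfl, rfl⟩, -⟩ := existsUnique_of_isLimit_binaryFan M (prodIsProd W₁ W₂) w₁ w₂
  refine ⟨s₁ ∪ s₂, W₁ ⨯ W₂, w, fun Q y k hw hs => ?_⟩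
  obtain ⟨f₁, hf₁, hf₁'⟩ := h₁ Q y k (hw.trans ⟨prod.fst, rfl, fun _ => rfl⟩)
    fun g hg => hs g (Finset.mem_union_left _ hg)
  obtain ⟨f₂, hf₂, hf₂'⟩ := h₂ Q y k (hw.trans ⟨prod.snd, rfl, fun _ => rfl⟩)
    fun g hg => hs g (Finset.mem_union_right _ hg)
  obtain ⟨f, hfst, hsnd⟩ := BinaryFan.IsLimit.lift' hP f₁ f₂
  have hfst : f ≫ p₁ = f₁ := hfst
  have hsnd : f ≫ p₂ = f₂ := hsnd
  refine ⟨f, ?_, fun i => ?_⟩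
  · refine (existsUnique_of_isLimit_binaryFan M hP _ _).unique ⟨?_, ?_⟩ ⟨rfl, rfl⟩
    · rw [← map_comp_app, hfst, hf₁]
    · rw [← map_comp_app, hsnd, hf₂]
  · refine (existsUnique_of_isLimit_binaryFan M hP _ _).unique ⟨?_, ?_⟩ ⟨rfl, rfl⟩
    · rw [← map_comp_app, hfst, hf₁']
    · rw [← map_comp_app, hsnd, hf₂']

theorem dia_mono {X : E} {A B : Sub E X} (h : A ≤ B) : dia A ≤ dia B := by
  have := ModalCategory.dia_sup A B
  rw [sup_eq_right.2 h] at this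
  exact le_sup_left.trans this.ge

/-- Product independence for points: if `(z, x) ∉ ⟦◇ψ⟧` and `x ∈ ⟦◇φ⟧`, then `z` is not in
`⟦◇(∀ y ∈ φ, (-, y) ∈ ψ)⟧`. -/
theorem IsBooleanModel.notMem_dia_forallMem (hM : IsBooleanModel M) {P X : E} {z : M.obj (P ⨯ X)}
    {φ : Sub E X} {ψ : Sub E (P ⨯ X)} (hφ : M.map prod.snd z ∈ interp M (dia φ))
    (hψ : z ∉ interp M (dia ψ)) : M.map prod.fst z ∉ interp M (dia (forallMem φ ψ)) := by
  intro h
  refine hψ (interp_mono M (dia_mono (inv_forallMem_inf_le φ ψ)) ?_)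
  refine interp_mono M (TopologicalModalCategory.product_independence _ _) ?_
  exact (hM.mem_interp_inf _ _ _).2 ⟨(hM.mem_interp_inv _ _ _).2 h, (hM.mem_interp_inv _ _ _).2 hφ⟩

theorem notMem_of_notMem_dia {X : E} {x : M.obj X} {φ : Sub E X}
    (h : x ∉ interp M (dia φ)) : x ∉ interp M φ :=
  fun hx => h (interp_mono M (TopologicalModalCategory.le_dia φ) hx)

/-- Product independence with `ψ = ⊥` shows that `⟦φ⟧` is nonempty as soon as `⟦◇φ⟧` is. The first
coordinate of `z` only has to be some point. -/
theorem IsBooleanModel.exists_satisfies (hM : IsBooleanModel M) :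
    ∃ i : Assignment M, i.Satisfies := by
  have key : ∀ g : Demand M, ∃ c, c ∈ interp M g.sub := fun g => by
    have := hM.lex
    obtain ⟨z, ⟨-, hz⟩, -⟩ :=
      existsUnique_of_isLimit_binaryFan M (prodIsProd g.obj g.obj) g.pt g.pt
    have hz : M.map prod.snd z = g.pt := hz
    have h := notMem_of_notMem_dia (hM.notMem_dia_forallMem (φ := g.sub) (ψ := ⊥) (z := z)
      (by rw [hz]; exact g.mem)
      (by rw [dia, ModalCategory.dia_bot, hM.interp_bot]; exact id))
    rw [hM.mem_interp_forallMem] at h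
    push Not at h
    obtain ⟨y, -, hy, -⟩ := h
    exact ⟨_, hy⟩
  choose i hi using key
  exact ⟨i, hi⟩

/-- Finitely many demands can be met, together with a parameter, outside any given `ψ` whose
diamond does not contain the prescribed points. -/
theorem IsBooleanModel.exists_maps (hM : IsBooleanModel M) {W : E} (w : M.obj W)
    (s : Finset (Demand M)) :
    ∃ (Q : E) (y : M.obj Q) (k : Assignment M → M.obj Q), Maps M y k w (fun _ => w) ∧
      (∀ g ∈ s, Maps M y k g.pt (fun i => i g)) ∧
      (∀ i j : Assignment M, (∀ g ∈ s, i g = j g) → k i = k j) ∧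
      ∀ ψ : Sub E Q, y ∉ interp M (dia ψ) → ∃ i : Assignment M, i.Satisfies ∧ k i ∉ interp M ψ := by
  classical
  have := hM.lex
  induction s using Finset.induction_on with
  | empty =>
    obtain ⟨i, hi⟩ := hM.exists_satisfies
    exact ⟨W, w, fun _ => w, ⟨𝟙 W, map_id_app M w, fun _ => map_id_app M w⟩, by simp,
      fun _ _ _ => rfl, fun ψ hψ => ⟨i, hi, notMem_of_notMem_dia hψ⟩⟩
  | insert g s hg ih =>
    obtain ⟨Q, y, k, hw, hs, hk, hψ⟩ := ih
    have hp := existsUnique_of_isLimit_binaryFan M (prodIsProd Q g.obj)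
    obtain ⟨z, hz, -⟩ := hp y g.pt
    choose l hl hl' using fun i : Assignment M => hp (k i) (i g)
    have hQ : Maps M z l y k := ⟨prod.fst, hz.1, fun i => (hl i).1⟩
    refine ⟨Q ⨯ g.obj, z, l, hQ.trans hw, ?_, ?_, ?_⟩
    · intro g' hg'
      rcases Finset.mem_insert.1 hg' with rfl | hg'
      · exact ⟨prod.snd, hz.2, fun i => (hl i).2⟩
      · exact hQ.trans (hs g' hg')
    · intro i j hij
      refine hl' j (l i) ⟨(hl i).1.trans (hk i j fun g' hg' => hij g' ?_),
        (hl i).2.trans (hij g ?_)⟩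
      · exact Finset.mem_insert_of_mem hg'
      · exact Finset.mem_insert_self _ _
    · intro ψ hzψ
      have hz₁ : M.map prod.fst z = y := hz.1
      have hz₂ : M.map prod.snd z = g.pt := hz.2
      -- Quantifying out the new coordinate over `g.sub` reduces to the induction hypothesis at `y`;
      -- the failing quantifier then supplies the value for `g`.
      have hy := hM.notMem_dia_forallMem (φ := g.sub) (by rw [hz₂]; exact g.mem) hzψ
      rw [hz₁] at hy
      obtain ⟨i, hi, hiψ⟩ := hψ _ hy
      rw [hM.mem_interp_forallMem] at hiψ
      push Not at hiψ
      obtain ⟨c, hc, hcφ, hcψ⟩ := hiψ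
      -- Since `k` depends only on the demands in `s` and `g ∉ s`, this change leaves `k i` intact.
      refine ⟨Function.update i g (M.map prod.snd c), fun g' => ?_, ?_⟩
      · by_cases h : g' = g
        · subst h
          rw [Function.update_self]
          exact hcφ
        · rw [Function.update_of_ne h]
          exact hi g'
      · rw [← hl' (Function.update i g (M.map prod.snd c)) c ⟨?_, ?_⟩]
        · exact hcψ
        · refine hc.trans (hk _ _ fun g' hg' => ?_)
          rw [Function.update_of_ne (ne_of_mem_of_not_mem hg' hg)]
        · rw [Function.update_self]

/-- Pulling `ψ` back along the arrow that produces `(x, h)` reduces to `IsBooleanModel.exists_maps`;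
laxness of `◇` keeps the source point outside the diamond. -/
theorem FinSupported.exists_satisfies_notMem (hM : IsBooleanModel M) {X : E} {x : M.obj X}
    {h : Assignment M → M.obj X} (hx : FinSupported x h) {ψ : Sub E X}
    (hψ : x ∉ interp M (dia ψ)) : ∃ i : Assignment M, i.Satisfies ∧ h i ∉ interp M ψ := by
  obtain ⟨s, W, w, H⟩ := hx
  obtain ⟨Q, y, k, hw, hs, -, hk⟩ := hM.exists_maps w s
  obtain ⟨f, rfl, hf⟩ := H Q y k hw hs
  obtain ⟨i, hi, hiψ⟩ := hk (inv f ψ) fun hy => hψ ((hM.mem_interp_inv _ _ _).1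
    (interp_mono M (ModalCategory.dia_inv_le f ψ) hy))
  refine ⟨i, hi, fun h' => hiψ ((hM.mem_interp_inv _ _ _).2 ?_)⟩
  rwa [hf]

theorem IsBooleanModel.notMem_dia_of_prod (hM : IsBooleanModel M) {X Y : E} {z : M.obj (X ⨯ Y)}
    {φ : Sub E X} {ψ : Sub E Y} (hφ : M.map prod.fst z ∉ interp M (dia φ))
    (hψ : M.map prod.snd z ∉ interp M (dia ψ)) :
    z ∉ interp M (dia (inv prod.fst φ ⊔ inv prod.snd ψ)) := by
  rw [dia, ModalCategory.dia_sup, hM.interp_sup]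
  rintro (h | h)
  · exact hφ ((hM.mem_interp_inv _ _ _).1 (interp_mono M (ModalCategory.dia_inv_le _ _) h))
  · exact hψ ((hM.mem_interp_inv _ _ _).1 (interp_mono M (ModalCategory.dia_inv_le _ _) h))

/-- The sets of satisfying assignments on which a supported family avoids `ψ`. -/
def avoidingSets (M : E ⥤ Type w) : Set (Set (Assignment M)) :=
  {S | ∃ (X : E) (x : M.obj X) (h : Assignment M → M.obj X) (ψ : Sub E X),
    FinSupported x h ∧ x ∉ interp M (dia ψ) ∧ S = {i | i.Satisfies ∧ h i ∉ interp M ψ}}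

/-- Avoiding `φ` and `ψ` separately amounts to the paired family avoiding the join of their inverse
images. -/
theorem IsBooleanModel.inter_mem_avoidingSets (hM : IsBooleanModel M)
    {S T : Set (Assignment M)} (hS : S ∈ avoidingSets M) (hT : T ∈ avoidingSets M) :
    S ∩ T ∈ avoidingSets M := by
  have := hM.lex
  obtain ⟨X, x, h, φ, hx, hφ, rfl⟩ := hS
  obtain ⟨Y, y, k, ψ, hy, hψ, rfl⟩ := hT
  have hp := existsUnique_of_isLimit_binaryFan M (prodIsProd X Y)
  obtain ⟨z, ⟨rfl, rfl⟩, -⟩ := hp x y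
  choose l hl _ using fun i => hp (h i) (k i)
  obtain rfl : (fun i => M.map prod.fst (l i)) = h := funext fun i => (hl i).1
  obtain rfl : (fun i => M.map prod.snd (l i)) = k := funext fun i => (hl i).2
  refine ⟨X ⨯ Y, z, l, inv prod.fst φ ⊔ inv prod.snd ψ, hx.pair hM (prodIsProd X Y) hy,
    hM.notMem_dia_of_prod hφ hψ, ?_⟩
  ext i
  rw [hM.interp_sup]
  simp only [Set.mem_inter_iff, Set.mem_ofPred_eq, Set.mem_union, hM.mem_interp_inv, not_or]
  tauto

theorem IsBooleanModel.nonempty_terminal (hM : IsBooleanModel M) : Nonempty (M.obj (⊤_ E)) := by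
  have := hM.lex
  have h := terminalIsTerminal.isTerminalObj M (⊤_ E)
  exact ⟨h.from PUnit PUnit.unit⟩

/-- An ultrafilter of assignments that satisfy all demands, containing the avoiding sets. -/
theorem IsBooleanModel.exists_ultrafilter (hM : IsBooleanModel M) :
    ∃ U : Ultrafilter (Assignment M), (∀ᶠ i in (U : Filter (Assignment M)), i.Satisfies) ∧
      ∀ {X : E} (x : M.obj X) (h : Assignment M → M.obj X) (ψ : Sub E X), FinSupported x h →
        x ∉ interp M (dia ψ) → ∀ᶠ i in (U : Filter (Assignment M)), h i ∉ interp M ψ := by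
  obtain ⟨t⟩ := hM.nonempty_terminal
  -- Avoiding `⊥` is no condition, so this is the set of all satisfying assignments.
  have ht : {i : Assignment M | i.Satisfies ∧ t ∉ interp M (⊥ : Sub E (⊤_ E))} ∈
      avoidingSets M :=
    ⟨_, t, fun _ => t, ⊥, finSupported_const t,
      by rw [dia, ModalCategory.dia_bot, hM.interp_bot]; exact id, rfl⟩
  let B : FilterBasis (Assignment M) :=
    { sets := avoidingSets M
      nonempty := ⟨_, ht⟩
      inter_sets := fun hS hT => ⟨_, hM.inter_mem_avoidingSets hS hT, subset_rfl⟩ }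
  have hB : ∀ S ∈ avoidingSets M, S ∈ B.filter := fun S hS => B.mem_filter_of_mem hS
  have : B.filter.NeBot := by
    refine B.hasBasis.neBot_iff.2 ?_
    rintro S ⟨X, x, h, ψ, hx, hψ, rfl⟩
    exact hx.exists_satisfies_notMem hM hψ
  refine ⟨Ultrafilter.of B.filter, ?_, fun x h ψ hx hψ => ?_⟩
  · exact mem_of_superset (Ultrafilter.of_le _ (hB _ ht)) fun i hi => hi.1
  · exact mem_of_superset (Ultrafilter.of_le _ (hB _ ⟨_, x, h, ψ, hx, hψ, rfl⟩)) fun i hi => hi.2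

end Extension

end

end ModalCat

-- The universe `max u v w` also contains the type of assignments, so the ultrapower takes values in
-- the same universe as `M`.
open ModalCat Filter in
theorem mainTheorem2 (E : Type u) [Category.{v} E] [HasFiniteLimits E]
    [ModalCat.TopologicalModalCategory E]
    (M : E ⥤ Type (max u v w)) (hM : ModalCat.IsBooleanModel M) :
    ∃ (N : E ⥤ Type (max u v w)) (μ : M ⟶ N) (R : ModalCat.FunctorRel M N),
      ModalCat.IsBooleanModel N ∧
      R.StableUnderProducts ∧
      R.ContainsGraph μ ∧
      ∀ (X : E) (φ : ModalCat.Sub E X),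
        ModalCat.interp M (ModalCat.dia φ) = R.preimage (ModalCat.interp N φ) := by
  obtain ⟨U, hU, hUψ⟩ := hM.exists_ultrafilter
  have := hM.lex
  refine ⟨ultrapower U M, toUltrapower U M, fun X => {p | ∃ h : Assignment M → M.obj X,
    FinSupported p.1 h ∧ p.2 = Germ.ofFun (l := (U : Filter (Assignment M))) h}, hM.ultrapower U, ?_, ?_, ?_⟩
  · rintro X Y P p₁ p₂ ⟨hP⟩ z z'
    refine Germ.inductionOn z' fun k => ?_
    rintro ⟨h₁, hs₁, hk₁⟩ ⟨h₂, hs₂, hk₂⟩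
    have hk₁ : ∀ᶠ i in (U : Filter _), M.map p₁ (k i) = h₁ i := Germ.coe_eq.1 hk₁
    have hk₂ : ∀ᶠ i in (U : Filter _), M.map p₂ (k i) = h₂ i := Germ.coe_eq.1 hk₂
    choose l hl hl' using fun i => existsUnique_of_isLimit_binaryFan M hP (h₁ i) (h₂ i)
    obtain rfl : (fun i => M.map p₁ (l i)) = h₁ := funext fun i => (hl i).1
    obtain rfl : (fun i => M.map p₂ (l i)) = h₂ := funext fun i => (hl i).2
    -- The given representative `k` has the supported components only almost everywhere, so it is
    -- replaced by `l`, which has them at every index.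
    refine ⟨l, hs₁.pair hM hP hs₂, Germ.coe_eq.2 ?_⟩
    filter_upwards [hk₁, hk₂] with i hi₁ hi₂
    exact hl' i _ ⟨hi₁, hi₂⟩
  · exact fun X x => ⟨fun _ => x, finSupported_const x, rfl⟩
  · intro X φ
    ext x
    constructor
    · intro hx
      let g : Demand M := ⟨X, φ, x, hx⟩
      exact ⟨Germ.ofFun (l := (U : Filter (Assignment M))) fun i => i g,
        (coe_mem_interp_ultrapower U M φ _).2 (hU.mono fun i hi => hi g), _,
        finSupported_eval g, rfl⟩
    · rintro ⟨_, hy, h, hs, rfl⟩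
      by_contra hx
      obtain ⟨i, hi, hi'⟩ :=
        (((coe_mem_interp_ultrapower U M φ h).1 hy).and (hUψ x h φ hs hx)).exists
      exact hi' hi
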